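/- For every $n\ge 1$ let $X_{n,1},\dots,X_{n,n}$ be independent real random variables on a probability space $(\Omega_n,P_n)$ (a triangular array; the laws may differ in $i$ and change with $n$), each with a law that is absolutely continuous with respect to Lebesgue measure. Write $X_i=X_{n,i}$, $P=P_n$, $[n]=\{1,\dots,n\}$, and let $$U_n^{\rm AP}=U_n^{\rm AP}(X_1,\dots,X_n)=\frac1{n(n-1)}\sum_{1\le i\ne j\le n}\frac{n\,\mathbf 1(j<i)}{i-1}\,\mathbf 1(X_j>X_i),\qquad \sigma_n^2={\rm Var}(U_n^{\rm AP}),\ \ \sigma_n\ge 0,$$ with the convention $0/0=0$. For real sequences write $a_n\gtrsim b_n$ if $|b_n|\le C|a_n|$ for some constant $C$ and all large $n$. Assume that there are sequences $\delta_n,p_n\in(0,1)$ such that for all sufficiently large $n$ and every $i\in[n]$ at least one of the following holds: (i) $P\{P(X_j>X_i\mid X_i)-P(X_j>X_i)\in[\delta_n,1]\ \text{for all } j\in[n]\setminus\{i\}\}\ge p_n$; (ii) $P\{P(X_j>X_i\mid X_i)-P(X_j>X_i)\in[-1,-\delta_n]\ \text{for all } j\in[n]\setminus\{i\}\}\ge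 p_n$; and that $\delta_n^3p_n\gtrsim n^{-1/3}(\log n)^2$ holds while $n^{-1/3}(\log n)^2\gtrsim\delta_n^3p_n$ does not. Assume further that there are constants $\theta>0$, $\eta^2>0$ and $C_1,C_2>0$, not depending on $n$, such that for all $n$ $$|P(X_i>X_j)-\theta|\le C_1n^{-1/6}\log n\quad\text{for all } i\ne j\text{ in }[n],$$ $$\bigl|E\{P(X_j>X_i\mid X_i)\,P(X_k>X_i\mid X_i)\}-\eta^2\bigr|\le C_2n^{-1/3}(\log n)^2\quad\text{for all } i,j,k\in[n],\ j\ne i,\ k\ne i,$$ and that $\eta^2\ne\theta^2$. Given $X_1,\dots,X_n$, let $X_1^*,\dots,X_n^*$ be i.i.d. draws from the empirical distribution of $X_1,\dots,X_n$, let $U_n^{{\rm AP}*}=U_n^{\rm AP}(X_1^*,\dots,X_n^*)$, and let ${\rm Var}^*$ denote the conditional variance given $X_1,\dots,X_n$. Then $\sigma_n>0$ for all sufficiently large $n$, and $$\bigl|{\rm Var}^*(\sigma_n^{-1}U_n^{{\rm AP}*})-{\rm Var}(\sigma_n^{-1}U_n^{\rm AP})\bigr|\to0\quad\text{in probability as }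 n\to\infty.$$ -/

import Mathlib

open MeasureTheory ProbabilityTheory Filter Topology Asymptotics
open scoped ENNReal

noncomputable section

/-- The strict asymptotic order: `b n ≲ a n` holds, but `a n ≲ b n` does not. -/
def StrictlyDominates (a b : ℕ → ℝ) : Prop :=
  b =O[atTop] a ∧ ¬ a =O[atTop] b

/-- The weight of the AP correlation.  The index `i : Fin n` stands for the `(i + 1)`-st observation,
so that `n 𝟙(j < i) / (i - 1)` in one-based indices becomes `n 𝟙(j < i) / i` here. -/
def apWeight (n : ℕ) (i j : Fin n) : ℝ :=
  if j < i then (n : ℝ) / (i : ℝ) else 0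

/-- The AP correlation
`U_n^AP(x₁, …, xₙ) = 1 / (n (n - 1)) * ∑_{i ≠ j} n 𝟙(j < i) / (i - 1) * 𝟙(x_j > x_i)`. -/
def apU (n : ℕ) (x : Fin n → ℝ) : ℝ :=
  1 / ((n : ℝ) * ((n : ℝ) - 1)) *
    ∑ i : Fin n, ∑ j : Fin n,
      if i ≠ j then apWeight n i j * (if x j > x i then 1 else 0) else 0

/-- The empirical distribution `n⁻¹ ∑ δ_{x_i}` of the points `x₁, …, xₙ`. -/
def empiricalMeasure {n : ℕ} (x : Fin n → ℝ) : Measure ℝ :=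
  (n : ℝ≥0∞)⁻¹ • ∑ i : Fin n, Measure.dirac (x i)

/-- The conditional law of the bootstrap sample `(X₁*, …, Xₙ*)` given the data `x`: independent
draws from the empirical distribution of `x`. -/
def bootstrapLaw {n : ℕ} (x : Fin n → ℝ) : Measure (Fin n → ℝ) :=
  Measure.pi fun _ : Fin n => empiricalMeasure x

/-- `Var*`: the conditional variance, given the data `x`, of the statistic `T` evaluated at the
bootstrap sample. -/
def bootstrapVariance {n : ℕ} (T : (Fin n → ℝ) → ℝ) (x : Fin n → ℝ) : ℝ :=
  variance T (bootstrapLaw x)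

/-- The conditional probability `P(Y > Z ∣ Z)`, as a random variable. -/
def condProbGT {Ω : Type*} [MeasurableSpace Ω] (μ : Measure Ω) (Y Z : Ω → ℝ) : Ω → ℝ :=
  μ⟦{ω | Y ω > Z ω} | MeasurableSpace.comap Z inferInstance⟧

/-- The statistic `U_n^AP` as a random variable. -/
def apStat {Ω : Type*} {n : ℕ} (X : Fin n → Ω → ℝ) : Ω → ℝ :=
  fun ω => apU n fun i => X i ω

/-- The standard deviation `σ_n` of `U_n^AP`. -/
def apSigma {Ω : Type*} [MeasurableSpace Ω] {n : ℕ} (μ : Measure Ω) (X : Fin n → Ω → ℝ) : ℝ :=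
  Real.sqrt (variance (apStat X) μ)

end

/-!
Up to the factor `(n - 1)⁻¹`, the AP correlation is the sum over `i` of the relative rank of `Xᵢ`
among its predecessors, the fraction of the `Xⱼ` with `j < i` that exceed `Xᵢ`. Without ties,
exactly one of two and exactly one of three observations is the smallest, so order probabilities
that are nearly constant over pairs and over triples must be close to `1/2` and `1/3`. Hence
`𝟙(Xᵢ < Xⱼ)` and `𝟙(Xᵢ < Xₖ)` have covariance close to `1/3 - 1/4 = 1/12`, and so the relative ranks
have variance close to `1/12`. Replacing one of these events by its complement changes the sign of
the covariance, and these signs make distinct relative ranks nearly uncorrelated. Therefore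
`(n - 1)² Var(U_n^AP) / n → 1/12`.

A bootstrap sample from data without ties is i.i.d. from a law with atoms of mass `1/n`, so the same
argument gives the same limit for the bootstrap variance, uniformly in the data.
-/

section Independence

variable {Ω α β : Type*} [MeasurableSpace Ω] [MeasurableSpace α] [MeasurableSpace β]
  {μ : Measure Ω} [IsProbabilityMeasure μ]

lemma measureReal_prodMk_mem_eq_integral {Z : Ω → α} {V : Ω → β} (hZ : Measurable Z)
    (hV : Measurable V) (h : IndepFun Z V μ) {S : Set (α × β)} (hS : MeasurableSet S) :
    μ.real {ω | (Z ω, V ω) ∈ S} = ∫ z, (μ.map V).real (Prod.mk z ⁻¹' S) ∂μ.map Z := by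
  have := Measure.isProbabilityMeasure_map (μ := μ) hV.aemeasurable
  have hlaw := (indepFun_iff_map_prod_eq_prod_map_map hZ.aemeasurable hV.aemeasurable).1 h
  calc μ.real {ω | (Z ω, V ω) ∈ S} = ((μ.map Z).prod (μ.map V)).real S := by
        rw [← hlaw, map_measureReal_apply (hZ.prodMk hV) hS]; rfl
    _ = (∫⁻ z, μ.map V (Prod.mk z ⁻¹' S) ∂μ.map Z).toReal := by
        rw [Measure.real, Measure.prod_apply hS]
    _ = _ := (integral_toReal (measurable_measure_prodMk_left hS).aemeasurable
        (ae_of_all _ fun _ => measure_lt_top _ _)).symm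

lemma condExp_prodMk_ae_eq_integral_map [StandardBorelSpace β] [Nonempty β] {F : Type*}
    [NormedAddCommGroup F] [NormedSpace ℝ F] [CompleteSpace F] {Z : Ω → α} {V : Ω → β}
    (hZ : Measurable Z) (hV : Measurable V) (h : IndepFun Z V μ) {f : α × β → F}
    (hf : StronglyMeasurable f) (hint : Integrable (fun ω => f (Z ω, V ω)) μ) :
    μ[fun ω => f (Z ω, V ω) | MeasurableSpace.comap Z inferInstance]
      =ᵐ[μ] fun ω => ∫ v, f (Z ω, v) ∂μ.map V := by
  have := Measure.isProbabilityMeasure_map (μ := μ) hV.aemeasurable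
  have hcond : condDistrib V Z μ =ᵐ[μ.map Z] Kernel.const α (μ.map V) := by
    refine condDistrib_ae_eq_of_measure_eq_compProd Z hV.aemeasurable ?_
    rw [Measure.compProd_const,
      (indepFun_iff_map_prod_eq_prod_map_map hZ.aemeasurable hV.aemeasurable).1 h]
  filter_upwards [condExp_prod_ae_eq_integral_condDistrib hZ hV.aemeasurable hf hint,
    ae_of_ae_map hZ.aemeasurable hcond] with ω hω hconst
  rw [hω, hconst, Kernel.const_apply]

section Order

variable [TopologicalSpace α] [OpensMeasurableSpace α] [LinearOrder α] [OrderClosedTopology α]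
  [SecondCountableTopology α]

lemma measureReal_lt_eq_integral {Y Z : Ω → α} (hY : Measurable Y) (hZ : Measurable Z)
    (h : IndepFun Z Y μ) :
    μ.real {ω | Z ω < Y ω} = ∫ z, (μ.map Y).real (Set.Ioi z) ∂μ.map Z :=
  measureReal_prodMk_mem_eq_integral hZ hY h (measurableSet_lt measurable_fst measurable_snd)

lemma measureReal_lt_and_lt_eq_integral {Y W Z : Ω → α} (hY : Measurable Y) (hW : Measurable W)
    (hZ : Measurable Z) (hYW : IndepFun Y W μ) (h : IndepFun Z (fun ω => (Y ω, W ω)) μ) :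
    μ.real {ω | Z ω < Y ω ∧ Z ω < W ω}
      = ∫ z, (μ.map Y).real (Set.Ioi z) * (μ.map W).real (Set.Ioi z) ∂μ.map Z := by
  have := Measure.isProbabilityMeasure_map (μ := μ) hW.aemeasurable
  have hS : MeasurableSet {q : α × α × α | q.1 < q.2.1 ∧ q.1 < q.2.2} := by measurability
  refine (measureReal_prodMk_mem_eq_integral hZ (hY.prodMk hW) h hS).trans ?_
  rw [(indepFun_iff_map_prod_eq_prod_map_map hY.aemeasurable hW.aemeasurable).1 hYW]
  simp_rw [← measureReal_prod_prod]
  rfl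

end Order

lemma condProbGT_ae_eq {Y Z : Ω → ℝ} (hY : Measurable Y) (hZ : Measurable Z)
    (h : IndepFun Z Y μ) :
    condProbGT μ Y Z =ᵐ[μ] fun ω => (μ.map Y).real (Set.Ioi (Z ω)) := by
  have hlt : MeasurableSet {q : ℝ × ℝ | q.1 < q.2} := measurableSet_lt measurable_fst measurable_snd
  filter_upwards [condExp_prodMk_ae_eq_integral_map hZ hY h
    (stronglyMeasurable_one.indicator hlt (f := (1 : ℝ × ℝ → ℝ)))
    ((integrable_const (1 : ℝ)).indicator (measurableSet_lt hZ hY))] with ω hω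
  exact hω.trans (integral_indicator_one measurableSet_Ioi)

lemma integral_condProbGT_mul {Y W Z : Ω → ℝ} (hY : Measurable Y) (hW : Measurable W)
    (hZ : Measurable Z) (hYW : IndepFun Y W μ) (h : IndepFun Z (fun ω => (Y ω, W ω)) μ) :
    ∫ ω, condProbGT μ Y Z ω * condProbGT μ W Z ω ∂μ = μ.real {ω | Z ω < Y ω ∧ Z ω < W ω} := by
  have hmeas (V : Ω → ℝ) : Measurable fun z => (μ.map V).real (Set.Ioi z) :=
    (Antitone.measurable fun _ _ hab => measure_mono (Set.Ioi_subset_Ioi hab)).ennreal_toReal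
  calc ∫ ω, condProbGT μ Y Z ω * condProbGT μ W Z ω ∂μ
      = ∫ ω, (μ.map Y).real (Set.Ioi (Z ω)) * (μ.map W).real (Set.Ioi (Z ω)) ∂μ :=
        integral_congr_ae
          ((condProbGT_ae_eq hY hZ (h.comp measurable_id measurable_fst)).mul
            (condProbGT_ae_eq hW hZ (h.comp measurable_id measurable_snd)))
    _ = ∫ z, (μ.map Y).real (Set.Ioi z) * (μ.map W).real (Set.Ioi z) ∂μ.map Z :=
        (integral_map hZ.aemeasurable
          ((hmeas Y).fun_mul (hmeas W)).aestronglyMeasurable).symm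
    _ = _ := (measureReal_lt_and_lt_eq_integral hY hW hZ hYW h).symm

lemma measureReal_eq_le_of_singleton_le [MeasurableEq α] {Y Z : Ω → α} (hY : Measurable Y)
    (hZ : Measurable Z) (h : IndepFun Z Y μ) {c : ℝ} (hc : ∀ y, (μ.map Y).real {y} ≤ c) :
    μ.real {ω | Z ω = Y ω} ≤ c := by
  have := Measure.isProbabilityMeasure_map (μ := μ) hY.aemeasurable
  have := Measure.isProbabilityMeasure_map (μ := μ) hZ.aemeasurable
  have hsection (z : α) : Prod.mk z ⁻¹' {q : α × α | q.1 = q.2} = {z} := by ext; simp [eq_comm]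
  calc μ.real {ω | Z ω = Y ω} = ∫ z, (μ.map Y).real {z} ∂μ.map Z := by
        simp_rw [← hsection]
        exact measureReal_prodMk_mem_eq_integral hZ hY h measurableSet_diagonal
    _ ≤ ∫ _, c ∂μ.map Z := integral_mono_of_nonneg (ae_of_all _ fun _ => measureReal_nonneg)
        (integrable_const c) (ae_of_all _ hc)
    _ = c := by simp

lemma ae_injective_of_iIndepFun [MeasurableEq α] {ι : Type*} [Countable ι] {Y : ι → Ω → α}
    (hY : ∀ i, Measurable (Y i)) (hind : iIndepFun Y μ)
    (hatom : ∀ i, NullSingletonClass (μ.map (Y i))) :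
    ∀ᵐ ω ∂μ, Function.Injective fun i => Y i ω := by
  have htie (i j : ι) (hij : i ≠ j) : ∀ᵐ ω ∂μ, Y i ω ≠ Y j ω := by
    have hle : μ.real {ω | Y i ω = Y j ω} ≤ 0 :=
      measureReal_eq_le_of_singleton_le (hY j) (hY i) (hind.indepFun hij) fun y => by
        simp [Measure.real, (hatom j).measure_singleton]
    simpa [ae_iff, measureReal_eq_zero_iff] using hle.antisymm measureReal_nonneg
  filter_upwards [ae_all_iff.2 fun i => ae_all_iff.2 fun j =>
    ae_all_iff.2 fun hij => htie i j hij] with ω hω i j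
  exact not_imp_not.1 (hω i j)

end Independence

section OrderProbabilities

variable {Ω α : Type*} [MeasurableSpace Ω] {μ : Measure Ω} [IsProbabilityMeasure μ]
  [TopologicalSpace α] [MeasurableSpace α] [OpensMeasurableSpace α] [LinearOrder α]
  [OrderClosedTopology α] [SecondCountableTopology α] {Y Z W : Ω → α}

lemma measureReal_lt_add_lt_add_eq (hY : Measurable Y) (hZ : Measurable Z) :
    μ.real {ω | Y ω < Z ω} + μ.real {ω | Z ω < Y ω} + μ.real {ω | Y ω = Z ω} = 1 := by
  have hcompl : {ω | Y ω < Z ω}ᶜ = {ω | Z ω < Y ω} ∪ {ω | Y ω = Z ω} := by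
    ext ω
    simp [le_iff_lt_or_eq, eq_comm]
  have hdisj : Disjoint {ω | Z ω < Y ω} {ω | Y ω = Z ω} :=
    Set.disjoint_left.2 fun _ hlt heq => hlt.ne' heq
  rw [add_assoc, ← measureReal_union hdisj (measurableSet_eq_fun hY hZ), ← hcompl,
    probReal_add_probReal_compl (measurableSet_lt hY hZ)]

lemma abs_sum_measureReal_min_sub_one_le (hY : Measurable Y) (hZ : Measurable Z)
    (hW : Measurable W) :
    |μ.real {ω | Y ω < Z ω ∧ Y ω < W ω} + μ.real {ω | Z ω < Y ω ∧ Z ω < W ω}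
        + μ.real {ω | W ω < Y ω ∧ W ω < Z ω} - 1|
      ≤ μ.real {ω | Y ω = Z ω} + μ.real {ω | Y ω = W ω} + μ.real {ω | Z ω = W ω} := by
  set A := {ω | Y ω < Z ω ∧ Y ω < W ω} ∪ {ω | Z ω < Y ω ∧ Z ω < W ω}
      ∪ {ω | W ω < Y ω ∧ W ω < Z ω} with hA
  have hmeas (U V T : Ω → α) (hU : Measurable U) (hV : Measurable V) (hT : Measurable T) :
      MeasurableSet {ω | U ω < V ω ∧ U ω < T ω} :=
    (measurableSet_lt hU hV).inter (measurableSet_lt hU hT)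
  have hsum : μ.real A = μ.real {ω | Y ω < Z ω ∧ Y ω < W ω}
      + μ.real {ω | Z ω < Y ω ∧ Z ω < W ω} + μ.real {ω | W ω < Y ω ∧ W ω < Z ω} := by
    rw [measureReal_union _ (hmeas W Y Z hW hY hZ), measureReal_union _ (hmeas Z Y W hZ hY hW)]
    all_goals refine Set.disjoint_left.2 fun ω h h' => ?_
    all_goals simp only [Set.mem_union, Set.mem_ofPred_eq] at h h'; grind
  have hties : Aᶜ ⊆ {ω | Y ω = Z ω} ∪ {ω | Y ω = W ω} ∪ {ω | Z ω = W ω} := fun ω hω => by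
    simp only [hA, Set.mem_compl_iff, Set.mem_union, Set.mem_ofPred_eq] at hω ⊢
    grind
  have hle : μ.real Aᶜ ≤ μ.real {ω | Y ω = Z ω} + μ.real {ω | Y ω = W ω}
      + μ.real {ω | Z ω = W ω} :=
    (measureReal_mono hties).trans <| (measureReal_union_le _ _).trans <| by
      gcongr
      exact measureReal_union_le _ _
  have hAmeas : MeasurableSet A :=
    ((hmeas Y Z W hY hZ hW).union (hmeas Z Y W hZ hY hW)).union (hmeas W Y Z hW hY hZ)
  rw [← hsum, abs_sub_comm, ← probReal_compl_eq_one_sub hAmeas, abs_of_nonneg measureReal_nonneg]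
  exact hle

end OrderProbabilities

section IndicatorCovariance

variable {Ω : Type*} [MeasurableSpace Ω] {μ : Measure Ω} [IsProbabilityMeasure μ] {A B : Set Ω}

lemma memLp_two_indicator_one (hA : MeasurableSet A) : MemLp (A.indicator (1 : Ω → ℝ)) 2 μ :=
  memLp_indicator_const 2 hA 1 (Or.inr (measure_ne_top μ A))

lemma covariance_indicator_one (hA : MeasurableSet A) (hB : MeasurableSet B) :
    cov[A.indicator 1, B.indicator 1; μ] = μ.real (A ∩ B) - μ.real A * μ.real B := by
  rw [covariance_eq_sub (memLp_two_indicator_one hA) (memLp_two_indicator_one hB),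
    ← Set.inter_indicator_one, integral_indicator_one (hA.inter hB), integral_indicator_one hA,
    integral_indicator_one hB]

lemma abs_covariance_indicator_one_le (hA : MeasurableSet A) (hB : MeasurableSet B) :
    |cov[A.indicator 1, B.indicator 1; μ]| ≤ μ.real A := by
  have hinter : μ.real (A ∩ B) ≤ μ.real A := measureReal_mono Set.inter_subset_left
  have hmul : μ.real A * μ.real B ≤ μ.real A := mul_le_of_le_one_right measureReal_nonneg
    measureReal_le_one
  rw [covariance_indicator_one hA hB]
  exact abs_sub_le_of_nonneg_of_le measureReal_nonneg hinter (by positivity) hmul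

lemma abs_covariance_indicator_one_self_sub_le (hA : MeasurableSet A) :
    |cov[A.indicator 1, A.indicator 1; μ] - 1 / 12| ≤ 1 := by
  have hle : μ.real A ≤ 1 := measureReal_le_one
  have hnonneg : 0 ≤ μ.real A := measureReal_nonneg
  rw [covariance_indicator_one hA hA, Set.inter_self, abs_le]
  constructor <;> nlinarith

end IndicatorCovariance

section NearlyExchangeable

variable {Ω ι : Type*}

/-- The indicator `𝟙(Y_i < Y_j)` that observation `j` exceeds observation `i`. -/
noncomputable def exceed (Y : ι → Ω → ℝ) (i j : ι) : Ω → ℝ :=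
  {ω | Y i ω < Y j ω}.indicator 1

/-- Independent observations whose pairs and triples are ordered, up to an error `r`, as if the
observations were exchangeable without ties: ties have probability at most `r`, and each of two
(of three) observations is the smallest with probability within `r` of `1/2` (of `1/3`). -/
structure IsNearlyExchangeable [MeasurableSpace Ω] (Y : ι → Ω → ℝ) (μ : Measure Ω) (r : ℝ) :
    Prop where
  measurable : ∀ i, Measurable (Y i)
  indep : iIndepFun Y μ
  tie_le : ∀ i j, i ≠ j → μ.real {ω | Y i ω = Y j ω} ≤ r
  abs_pair_le : ∀ i j, i ≠ j → |μ.real {ω | Y i ω < Y j ω} - 1 / 2| ≤ r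
  abs_triple_le : ∀ i j k, i ≠ j → i ≠ k → j ≠ k →
    |μ.real {ω | Y i ω < Y j ω ∧ Y i ω < Y k ω} - 1 / 3| ≤ r

variable [MeasurableSpace Ω] {μ : Measure Ω} {Y : ι → Ω → ℝ} {r : ℝ}

lemma IsNearlyExchangeable.nonneg (h : IsNearlyExchangeable Y μ r) {i j : ι} (hij : i ≠ j) :
    0 ≤ r :=
  measureReal_nonneg.trans (h.tie_le i j hij)

variable [IsProbabilityMeasure μ]

lemma memLp_two_exceed (hY : ∀ i, Measurable (Y i)) (i j : ι) : MemLp (exceed Y i j) 2 μ :=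
  memLp_two_indicator_one (measurableSet_lt (hY i) (hY j))

lemma covariance_exceed_of_disjoint (hY : ∀ i, Measurable (Y i)) (hind : iIndepFun Y μ)
    {i j k l : ι} (hik : i ≠ k) (hil : i ≠ l) (hjk : j ≠ k) (hjl : j ≠ l) :
    cov[exceed Y i j, exceed Y k l; μ] = 0 := by
  have hlt : Measurable ({q : ℝ × ℝ | q.1 < q.2}.indicator (1 : ℝ × ℝ → ℝ)) :=
    measurable_one.indicator (measurableSet_lt measurable_fst measurable_snd)
  exact IndepFun.covariance_eq_zero
    ((hind.indepFun_prodMk_prodMk hY i j k l hik hil hjk hjl).comp hlt hlt)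
    (memLp_two_exceed hY i j) (memLp_two_exceed hY k l)

namespace IsNearlyExchangeable

lemma of_abs_sub_le (hY : ∀ i, Measurable (Y i)) (hind : iIndepFun Y μ) {θ κ a c : ℝ}
    (htie : ∀ i j, i ≠ j → μ.real {ω | Y i ω = Y j ω} ≤ c)
    (hpair : ∀ i j, i ≠ j → |μ.real {ω | Y i ω < Y j ω} - θ| ≤ a)
    (htriple : ∀ i j k, i ≠ j → i ≠ k → j ≠ k →
      |μ.real {ω | Y i ω < Y j ω ∧ Y i ω < Y k ω} - κ| ≤ a) :
    IsNearlyExchangeable Y μ (2 * a + c) where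
  measurable := hY
  indep := hind
  tie_le i j hij := by
    linarith [htie i j hij, (abs_nonneg _).trans (hpair i j hij)]
  abs_pair_le i j hij := by
    have hsum := measureReal_lt_add_lt_add_eq (μ := μ) (hY i) (hY j)
    have htie_nonneg : 0 ≤ μ.real {ω | Y i ω = Y j ω} := measureReal_nonneg
    have hle := htie i j hij
    have hij' := abs_le.1 (hpair i j hij)
    have hji := abs_le.1 (hpair j i hij.symm)
    rw [abs_le]
    constructor <;> linarith
  abs_triple_le i j k hij hik hjk := by
    have hsum := abs_le.1 (abs_sum_measureReal_min_sub_one_le (μ := μ) (hY i) (hY j) (hY k))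
    have hi := abs_le.1 (htriple i j k hij hik hjk)
    have hj := abs_le.1 (htriple j i k hij.symm hjk hik)
    have hk := abs_le.1 (htriple k i j hik.symm hjk.symm hij)
    have hties := add_le_add (add_le_add (htie i j hij) (htie i k hik)) (htie j k hjk)
    rw [abs_le]
    constructor <;> linarith

lemma of_ae_injective (hY : ∀ i, Measurable (Y i)) (hind : iIndepFun Y μ)
    (hinj : ∀ᵐ ω ∂μ, Function.Injective fun i => Y i ω) {θ κ a b : ℝ}
    (hpair : ∀ i j, i ≠ j → |μ.real {ω | Y i ω > Y j ω} - θ| ≤ a)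
    (htriple : ∀ i j k, j ≠ i → k ≠ i → j ≠ k →
      |∫ ω, condProbGT μ (Y j) (Y i) ω * condProbGT μ (Y k) (Y i) ω ∂μ - κ| ≤ b) :
    IsNearlyExchangeable Y μ (2 * max a b) := by
  suffices h : IsNearlyExchangeable Y μ (2 * max a b + 0) by rwa [add_zero] at h
  refine of_abs_sub_le (θ := θ) (κ := κ) hY hind ?_ ?_ ?_
  · intro i j hij
    have htie : μ {ω | Y i ω = Y j ω} = 0 :=
      measure_eq_zero_iff_ae_notMem.2 (hinj.mono fun _ hω => hω.ne hij)
    exact ((measureReal_eq_zero_iff).2 htie).le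
  · exact fun i j hij => (hpair j i hij.symm).trans (le_max_left a b)
  · intro i j k hij hik hjk
    rw [← integral_condProbGT_mul (hY j) (hY k) (hY i) (hind.indepFun hjk)
      (hind.indepFun_prodMk hY j k i hij.symm hik.symm).symm]
    exact (htriple i j k hij.symm hik.symm hjk).trans (le_max_right a b)

lemma of_map_eq (hY : ∀ i, Measurable (Y i)) (hind : iIndepFun Y μ) {ν : Measure ℝ}
    (hlaw : ∀ i, μ.map (Y i) = ν) {c : ℝ} (hatom : ∀ y, ν.real {y} ≤ c) :
    IsNearlyExchangeable Y μ c := by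
  suffices h : IsNearlyExchangeable Y μ (2 * 0 + c) by simpa using h
  refine of_abs_sub_le hY hind (θ := ∫ z, ν.real (Set.Ioi z) ∂ν)
    (κ := ∫ z, ν.real (Set.Ioi z) * ν.real (Set.Ioi z) ∂ν) ?_ ?_ ?_
  · intro i j hij
    exact measureReal_eq_le_of_singleton_le (hY j) (hY i) (hind.indepFun hij)
      (by rwa [hlaw j])
  · intro i j hij
    rw [measureReal_lt_eq_integral (hY j) (hY i) (hind.indepFun hij), hlaw, hlaw, sub_self,
      abs_zero]
  · intro i j k hij hik hjk
    rw [measureReal_lt_and_lt_eq_integral (hY j) (hY k) (hY i) (hind.indepFun hjk)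
      (hind.indepFun_prodMk hY j k i hij.symm hik.symm).symm, hlaw, hlaw, hlaw, sub_self, abs_zero]

lemma abs_covariance_exceed_add_swap_le (h : IsNearlyExchangeable Y μ r) {i j : ι} (hij : i ≠ j)
    (k l : ι) :
    |cov[exceed Y i j, exceed Y k l; μ] + cov[exceed Y j i, exceed Y k l; μ]| ≤ r := by
  set tie : Set Ω := {ω | Y i ω = Y j ω}
  have htie : MeasurableSet tie := measurableSet_eq_fun (h.measurable i) (h.measurable j)
  have hL := memLp_two_exceed (μ := μ) h.measurable
  have htri : exceed Y i j + exceed Y j i = fun ω => 1 - tie.indicator 1 ω := by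
    ext ω
    rcases lt_trichotomy (Y i ω) (Y j ω) with hlt | heq | hgt
    · simp [exceed, tie, hlt, hlt.not_gt, hlt.ne]
    · simp [exceed, tie, heq]
    · simp [exceed, tie, hgt, hgt.not_gt, hgt.ne']
  rw [← covariance_add_left (hL i j) (hL j i) (hL k l), htri,
    covariance_const_sub_left ((memLp_two_indicator_one htie).integrable one_le_two), abs_neg]
  exact (abs_covariance_indicator_one_le htie
    (measurableSet_lt (h.measurable k) (h.measurable l))).trans (h.tie_le i j hij)

lemma abs_covariance_exceed_min_sub_le (h : IsNearlyExchangeable Y μ r) {i j k : ι} (hij : i ≠ j)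
    (hik : i ≠ k) (hjk : j ≠ k) : |cov[exceed Y i j, exceed Y i k; μ] - 1 / 12| ≤ 3 * r := by
  have hr := h.nonneg hij
  have hprod : |μ.real {ω | Y i ω < Y j ω} * μ.real {ω | Y i ω < Y k ω} - 1 / 2 * (1 / 2)|
      ≤ 2 * r := by
    set p := μ.real {ω | Y i ω < Y j ω}
    set q := μ.real {ω | Y i ω < Y k ω}
    calc |p * q - 1 / 2 * (1 / 2)| = |p * (q - 1 / 2) + (p - 1 / 2) * (1 / 2)| := by ring_nf
      _ ≤ |p| * |q - 1 / 2| + |p - 1 / 2| * |1 / 2| := by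
        simpa only [abs_mul] using abs_add_le (p * (q - 1 / 2)) ((p - 1 / 2) * (1 / 2))
      _ ≤ 1 * r + r * 1 := by
        gcongr
        · exact (abs_of_nonneg measureReal_nonneg).trans_le measureReal_le_one
        · exact h.abs_pair_le i k hik
        · exact h.abs_pair_le i j hij
        · norm_num
      _ = 2 * r := by ring
  rw [exceed, exceed, covariance_indicator_one
    (measurableSet_lt (h.measurable i) (h.measurable j))
    (measurableSet_lt (h.measurable i) (h.measurable k)), ← Set.ofPred_and]
  rw [abs_le] at hprod ⊢
  have htriple := abs_le.1 (h.abs_triple_le i j k hij hik hjk)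
  constructor <;> linarith

lemma abs_covariance_exceed_chain_add_le (h : IsNearlyExchangeable Y μ r) {i k l : ι}
    (hik : i ≠ k) (hil : i ≠ l) (hkl : k ≠ l) :
    |cov[exceed Y i k, exceed Y k l; μ] + 1 / 12| ≤ 4 * r := by
  have hswap := abs_le.1 (h.abs_covariance_exceed_add_swap_le hik k l)
  have hmin := abs_le.1 (h.abs_covariance_exceed_min_sub_le hik.symm hkl hil)
  rw [abs_le]
  constructor <;> linarith

lemma abs_covariance_exceed_max_sub_le (h : IsNearlyExchangeable Y μ r) {i k l : ι}
    (hik : i ≠ k) (hil : i ≠ l) (hkl : k ≠ l) :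
    |cov[exceed Y i l, exceed Y k l; μ] - 1 / 12| ≤ 5 * r := by
  have hswap := abs_le.1 (h.abs_covariance_exceed_add_swap_le hil k l)
  have hchain := abs_le.1 (h.abs_covariance_exceed_chain_add_le hkl hik.symm hil.symm)
  rw [covariance_comm] at hchain
  rw [abs_le]
  constructor <;> linarith

end IsNearlyExchangeable

end NearlyExchangeable

lemma abs_inv_card_mul_sum_sub_le {ι : Type*} {s : Finset ι} (hs : s.Nonempty) {f e : ι → ℝ}
    {c : ℝ} (hf : ∀ j ∈ s, |f j - c| ≤ e j) :
    |(s.card : ℝ)⁻¹ * ∑ j ∈ s, f j - c| ≤ (s.card : ℝ)⁻¹ * ∑ j ∈ s, e j := by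
  have hcard : (s.card : ℝ) ≠ 0 := Nat.cast_ne_zero.2 hs.card_pos.ne'
  have hcentre : (s.card : ℝ)⁻¹ * ∑ j ∈ s, f j - c = (s.card : ℝ)⁻¹ * ∑ j ∈ s, (f j - c) := by
    rw [Finset.sum_sub_distrib, Finset.sum_const, nsmul_eq_mul, mul_sub,
      inv_mul_cancel_left₀ hcard]
  rw [hcentre, abs_mul, abs_inv, Nat.abs_cast]
  gcongr
  exact (Finset.abs_sum_le_sum_abs _ _).trans (Finset.sum_le_sum hf)

section RelativeRank

variable {Ω ι : Type*} [LinearOrder ι] [LocallyFiniteOrderBot ι]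

/-- The relative rank of observation `i`: the fraction of the earlier observations that exceed it.
It is `0` when there is no earlier observation. -/
noncomputable def relRank (Y : ι → Ω → ℝ) (i : ι) : Ω → ℝ :=
  fun ω => ((Finset.Iio i).card : ℝ)⁻¹ * ∑ j ∈ Finset.Iio i, exceed Y i j ω

variable [MeasurableSpace Ω] {μ : Measure Ω} [IsProbabilityMeasure μ] {Y : ι → Ω → ℝ} {r : ℝ}

lemma memLp_two_relRank (hY : ∀ i, Measurable (Y i)) (i : ι) : MemLp (relRank Y i) 2 μ :=
  (memLp_finsetSum _ fun j _ => memLp_two_exceed hY i j).const_mul _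

lemma covariance_relRank_left (hY : ∀ i, Measurable (Y i)) (i : ι) {T : Ω → ℝ}
    (hT : MemLp T 2 μ) :
    cov[relRank Y i, T; μ]
      = ((Finset.Iio i).card : ℝ)⁻¹ * ∑ j ∈ Finset.Iio i, cov[exceed Y i j, T; μ] := by
  unfold relRank
  rw [covariance_const_mul_left,
    covariance_fun_sum_left' (fun j _ => memLp_two_exceed hY i j) hT]

lemma covariance_relRank_right (hY : ∀ i, Measurable (Y i)) (i : ι) {T : Ω → ℝ}
    (hT : MemLp T 2 μ) :
    cov[T, relRank Y i; μ]
      = ((Finset.Iio i).card : ℝ)⁻¹ * ∑ j ∈ Finset.Iio i, cov[T, exceed Y i j; μ] := by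
  rw [covariance_comm, covariance_relRank_left hY i hT]
  simp_rw [covariance_comm]

namespace IsNearlyExchangeable

/-- Only the earlier observations `k` and `l` contribute, and their contributions nearly cancel. -/
lemma abs_covariance_relRank_exceed_le (h : IsNearlyExchangeable Y μ r) {i k l : ι} (hki : k < i)
    (hlk : l < k) :
    |cov[relRank Y i, exceed Y k l; μ]| ≤ 9 * r / (Finset.Iio i).card := by
  have hli : l < i := hlk.trans hki
  have hmem : {k, l} ⊆ Finset.Iio i := by
    simp [Finset.insert_subset_iff, hki, hli]
  have hzero : ∀ j ∈ Finset.Iio i, j ∉ ({k, l} : Finset ι) →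
      cov[exceed Y i j, exceed Y k l; μ] = 0 := fun j _ hj => by
    simp only [Finset.mem_insert, Finset.mem_singleton, not_or] at hj
    exact covariance_exceed_of_disjoint h.measurable h.indep hki.ne' hli.ne' hj.1 hj.2
  have hchain := abs_le.1 (h.abs_covariance_exceed_chain_add_le hki.ne' hli.ne' hlk.ne')
  have hmax := abs_le.1 (h.abs_covariance_exceed_max_sub_le hki.ne' hli.ne' hlk.ne')
  rw [covariance_relRank_left h.measurable i (memLp_two_exceed h.measurable k l),
    ← Finset.sum_subset hmem hzero, Finset.sum_pair hlk.ne', abs_mul, abs_inv, Nat.abs_cast,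
    inv_mul_eq_div]
  gcongr
  rw [abs_le]
  constructor <;> linarith

lemma abs_covariance_relRank_relRank_le (h : IsNearlyExchangeable Y μ r) {i k : ι} (hki : k < i) :
    |cov[relRank Y i, relRank Y k; μ]| ≤ 9 * r / (Finset.Iio i).card := by
  have hr : 0 ≤ r := h.nonneg hki.ne
  rw [covariance_relRank_right h.measurable k (memLp_two_relRank h.measurable i)]
  rcases (Finset.Iio k).eq_empty_or_nonempty with hk | hk
  · rw [hk, Finset.sum_empty, mul_zero, abs_zero]
    positivity
  · have hcard : ((Finset.Iio k).card : ℝ) ≠ 0 := Nat.cast_ne_zero.2 hk.card_pos.ne'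
    have hmean := abs_inv_card_mul_sum_sub_le hk (c := 0) fun l hl =>
      (sub_zero (cov[relRank Y i, exceed Y k l; μ])).symm ▸
        h.abs_covariance_relRank_exceed_le hki (Finset.mem_Iio.1 hl)
    rwa [sub_zero, Finset.sum_const, nsmul_eq_mul, inv_mul_cancel_left₀ hcard] at hmean

lemma abs_sum_covariance_relRank_le (h : IsNearlyExchangeable Y μ r) (hr : 0 ≤ r) (i : ι) :
    |∑ k ∈ Finset.Iio i, cov[relRank Y i, relRank Y k; μ]| ≤ 9 * r := by
  refine (Finset.abs_sum_le_sum_abs _ _).trans <| (Finset.sum_le_card_nsmul _ _ _ fun k hk =>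
    h.abs_covariance_relRank_relRank_le (Finset.mem_Iio.1 hk)).trans ?_
  rw [nsmul_eq_mul, mul_div_left_comm]
  exact mul_le_of_le_one_right (by positivity) (div_self_le_one _)

lemma abs_covariance_relRank_exceed_self_sub_le (h : IsNearlyExchangeable Y μ r) {i j : ι}
    (hji : j < i) :
    |cov[relRank Y i, exceed Y i j; μ] - 1 / 12| ≤ 3 * r + 1 / (Finset.Iio i).card := by
  have hr : 0 ≤ r := h.nonneg hji.ne
  have hj : j ∈ Finset.Iio i := Finset.mem_Iio.2 hji
  have hcard : ((Finset.Iio i).card : ℝ) ≠ 0 := Nat.cast_ne_zero.2 (Finset.card_pos.2 ⟨j, hj⟩).ne'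
  have hentry : ∀ k ∈ Finset.Iio i, |cov[exceed Y i k, exceed Y i j; μ] - 1 / 12|
      ≤ 3 * r + if k = j then 1 else 0 := fun k hk => by
    split_ifs with hkj
    · subst hkj
      exact (abs_covariance_indicator_one_self_sub_le
        (measurableSet_lt (h.measurable i) (h.measurable k))).trans (by linarith)
    · rw [add_zero]
      exact h.abs_covariance_exceed_min_sub_le (Finset.mem_Iio.1 hk).ne' hji.ne' hkj
  rw [covariance_relRank_left h.measurable i (memLp_two_exceed h.measurable i j)]
  refine (abs_inv_card_mul_sum_sub_le ⟨j, hj⟩ hentry).trans_eq ?_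
  rw [Finset.sum_add_distrib, Finset.sum_ite_eq', if_pos hj, Finset.sum_const, nsmul_eq_mul,
    mul_add, inv_mul_cancel_left₀ hcard, mul_one, one_div]

lemma abs_variance_relRank_sub_le [Nontrivial ι] (h : IsNearlyExchangeable Y μ r) (i : ι) :
    |Var[relRank Y i; μ] - 1 / 12| ≤ 3 * r + 2 / ((Finset.Iio i).card + 1) := by
  obtain ⟨k, hki⟩ := exists_ne i
  have hr : 0 ≤ r := h.nonneg hki
  rw [← covariance_self (memLp_two_relRank h.measurable i).aemeasurable,
    covariance_relRank_right h.measurable i (memLp_two_relRank h.measurable i)]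
  rcases (Finset.Iio i).eq_empty_or_nonempty with hi | hi
  · rw [hi, Finset.sum_empty, mul_zero, Finset.card_empty]
    norm_num
    linarith
  · have hcard : 1 ≤ ((Finset.Iio i).card : ℝ) := Nat.one_le_cast.2 hi.card_pos
    have hmean := abs_inv_card_mul_sum_sub_le hi fun j hj =>
      h.abs_covariance_relRank_exceed_self_sub_le (Finset.mem_Iio.1 hj)
    rw [Finset.sum_const, nsmul_eq_mul, inv_mul_cancel_left₀ (by positivity)] at hmean
    refine hmean.trans (add_le_add_right ?_ _)
    rw [div_le_div_iff₀ (by positivity) (by positivity)]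
    linarith

end IsNearlyExchangeable

end RelativeRank

section SumVariance

variable {Ω ι : Type*} [MeasurableSpace Ω] {μ : Measure Ω} [IsFiniteMeasure μ] [LinearOrder ι]
  [Fintype ι] [LocallyFiniteOrderBot ι]

lemma variance_fun_sum_eq_sum_variance_add {X : ι → Ω → ℝ} (hX : ∀ i, MemLp (X i) 2 μ) :
    Var[fun ω => ∑ i, X i ω; μ]
      = ∑ i, Var[X i; μ] + 2 * ∑ i, ∑ k ∈ Finset.Iio i, cov[X i, X k; μ] := by
  have hrow (i : ι) : ∑ k, cov[X i, X k; μ] = Var[X i; μ]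
      + (∑ k ∈ Finset.Iio i, cov[X i, X k; μ] + ∑ k with i < k, cov[X i, X k; μ]) := by
    have hIic : Finset.univ.filter (¬ i < ·) = insert i (Finset.Iio i) := by
      ext k
      simp [le_iff_eq_or_lt]
    rw [← Finset.sum_filter_add_sum_filter_not _ (i < ·), hIic, Finset.sum_insert (by simp),
      covariance_self (hX i).aemeasurable]
    ring
  have hswap : ∑ i, ∑ k with i < k, cov[X i, X k; μ]
      = ∑ i, ∑ k ∈ Finset.Iio i, cov[X i, X k; μ] := by
    rw [Finset.sum_comm' (t' := Finset.univ) (s' := Finset.Iio) (by simp)]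
    simp_rw [covariance_comm]
  rw [variance_fun_sum hX]
  simp_rw [hrow, Finset.sum_add_distrib]
  rw [hswap, two_mul]

end SumVariance

section APCorrelation

variable {n : ℕ}

lemma apStat_eq_sum_relRank {Ω : Type*} (Y : Fin n → Ω → ℝ) :
    apStat Y = fun ω => ((n : ℝ) - 1)⁻¹ * ∑ i, relRank Y i ω := by
  ext ω
  simp only [apStat, apU, relRank, Fin.card_Iio, Finset.mul_sum]
  refine Finset.sum_congr rfl fun i _ => ?_
  have hn : (n : ℝ) ≠ 0 := Nat.cast_ne_zero.2 i.pos.ne'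
  rw [← Finset.filter_gt_eq_Iio, Finset.sum_filter]
  refine Finset.sum_congr rfl fun j _ => ?_
  by_cases hji : j < i
  · simp only [apWeight, exceed, Set.indicator_apply, if_pos hji, if_pos hji.ne',
      Set.mem_ofPred_eq, Pi.one_apply, gt_iff_lt]
    field_simp
  · simp [apWeight, hji]

variable {Ω : Type*} [MeasurableSpace Ω] {μ : Measure Ω} [IsProbabilityMeasure μ]
  {Y : Fin n → Ω → ℝ} {r : ℝ}

namespace IsNearlyExchangeable

lemma abs_variance_sum_relRank_sub_le (h : IsNearlyExchangeable Y μ r) (hn : 2 ≤ n) :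
    |Var[fun ω => ∑ i, relRank Y i ω; μ] - n * (1 / 12)| ≤ n * (21 * r) + 2 * harmonic n := by
  have : Nontrivial (Fin n) := Fin.nontrivial_iff_two_le.2 hn
  obtain ⟨i, j, hij⟩ := exists_pair_ne (Fin n)
  have hr : 0 ≤ r := h.nonneg hij
  have hvar : |∑ i, Var[relRank Y i; μ] - n * (1 / 12)| ≤ n * (3 * r) + 2 * harmonic n := by
    calc |∑ i, Var[relRank Y i; μ] - n * (1 / 12)|
        = |∑ i, (Var[relRank Y i; μ] - 1 / 12)| := by simp [Finset.sum_sub_distrib]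
      _ ≤ ∑ i : Fin n, (3 * r + 2 / ((i : ℝ) + 1)) :=
        (Finset.abs_sum_le_sum_abs _ _).trans <| Finset.sum_le_sum fun i _ => by
          simpa only [Fin.card_Iio] using h.abs_variance_relRank_sub_le i
      _ = n * (3 * r) + 2 * harmonic n := by
        rw [Fin.sum_univ_eq_sum_range fun i => 3 * r + 2 / ((i : ℝ) + 1)]
        simp [Finset.sum_add_distrib, harmonic, Finset.mul_sum, div_eq_mul_inv]
  have hcov : |∑ i, ∑ k ∈ Finset.Iio i, cov[relRank Y i, relRank Y k; μ]| ≤ n * (9 * r) :=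
    (Finset.abs_sum_le_sum_abs _ _).trans <|
      (Finset.sum_le_sum fun i _ => h.abs_sum_covariance_relRank_le hr i).trans_eq (by simp)
  rw [variance_fun_sum_eq_sum_variance_add (memLp_two_relRank h.measurable)]
  rw [abs_le] at hvar hcov ⊢
  constructor <;> linarith

theorem abs_variance_apStat_sub_le (h : IsNearlyExchangeable Y μ r) (hn : 2 ≤ n) :
    |((n : ℝ) - 1) ^ 2 / n * Var[apStat Y; μ] - 1 / 12| ≤ 21 * r + 2 * harmonic n / n := by
  have hn0 : (n : ℝ) ≠ 0 := by positivity
  have hn1 : (n : ℝ) - 1 ≠ 0 := sub_ne_zero.2 (by exact_mod_cast (by lia : n ≠ 1))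
  have hscale : ((n : ℝ) - 1) ^ 2 / n * Var[apStat Y; μ] - 1 / 12
      = (n : ℝ)⁻¹ * (Var[fun ω => ∑ i, relRank Y i ω; μ] - n * (1 / 12)) := by
    rw [apStat_eq_sum_relRank, variance_const_mul]
    field_simp
  calc _ = (n : ℝ)⁻¹ * |Var[fun ω => ∑ i, relRank Y i ω; μ] - n * (1 / 12)| := by
        rw [hscale, abs_mul, abs_inv, Nat.abs_cast]
    _ ≤ (n : ℝ)⁻¹ * (n * (21 * r) + 2 * harmonic n) := by
        gcongr
        exact h.abs_variance_sum_relRank_sub_le hn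
    _ = 21 * r + 2 * harmonic n / n := by field_simp

end IsNearlyExchangeable

end APCorrelation

section Bootstrap

variable {n : ℕ} {x : Fin n → ℝ}

lemma isProbabilityMeasure_empiricalMeasure (hn : n ≠ 0) (x : Fin n → ℝ) :
    IsProbabilityMeasure (empiricalMeasure x) where
  measure_univ := by simp [empiricalMeasure, ENNReal.inv_mul_cancel, hn]

lemma empiricalMeasure_real_singleton_le (hx : Function.Injective x) (y : ℝ) :
    (empiricalMeasure x).real {y} ≤ (n : ℝ)⁻¹ := by
  have hcount : ∑ i, Measure.dirac (x i) {y} ≤ 1 := by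
    have hcard : (Finset.univ.filter fun i => x i = y).card ≤ 1 :=
      Finset.card_le_one.2 fun i hi j hj =>
        hx ((Finset.mem_filter.1 hi).2.trans (Finset.mem_filter.1 hj).2.symm)
    simpa [Set.indicator_apply, Finset.sum_boole] using hcard
  rw [empiricalMeasure, measureReal_ennreal_smul_apply, ENNReal.toReal_inv, ENNReal.toReal_natCast]
  refine mul_le_of_le_one_right (by positivity) ?_
  rw [Measure.real, Measure.finsetSum_apply]
  exact ENNReal.toReal_mono ENNReal.one_ne_top hcount

lemma isProbabilityMeasure_bootstrapLaw (hn : n ≠ 0) (x : Fin n → ℝ) :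
    IsProbabilityMeasure (bootstrapLaw x) := by
  have := isProbabilityMeasure_empiricalMeasure hn x
  unfold bootstrapLaw
  infer_instance

lemma isNearlyExchangeable_bootstrapLaw (hn : n ≠ 0) (hx : Function.Injective x) :
    IsNearlyExchangeable (fun i (y : Fin n → ℝ) => y i) (bootstrapLaw x) (n : ℝ)⁻¹ := by
  have := isProbabilityMeasure_empiricalMeasure hn x
  have := isProbabilityMeasure_bootstrapLaw hn x
  exact .of_map_eq measurable_pi_apply (iIndepFun_pi fun _ => aemeasurable_id)
    (fun i => (measurePreserving_eval _ i).map_eq) (empiricalMeasure_real_singleton_le hx)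

end Bootstrap

section VarianceRatio

variable {Ω : Type*} [MeasurableSpace Ω] {μ : Measure Ω} {n : ℕ} {Y : Fin n → Ω → ℝ}

lemma abs_inv_mul_sub_one_le {N v w τ e : ℝ} (hτ : 0 < τ) (hv : |N * v - τ| ≤ e)
    (hw : |N * w - τ| ≤ e) (he : e ≤ τ / 2) : |v⁻¹ * w - 1| ≤ 4 * e / τ := by
  rw [abs_le] at hv hw
  have hNv : τ / 2 ≤ N * v := by linarith
  have hpos : 0 < N * v := by linarith
  have hN : N ≠ 0 := left_ne_zero_of_mul hpos.ne'
  have hv0 : v ≠ 0 := right_ne_zero_of_mul hpos.ne'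
  have hratio : v⁻¹ * w - 1 = (N * w - N * v) / (N * v) := by field_simp
  rw [hratio, abs_div, abs_of_pos hpos]
  calc |N * w - N * v| / (N * v) ≤ 2 * e / (τ / 2) := by
        gcongr
        · linarith
        · exact abs_le.2 ⟨by linarith, by linarith⟩
    _ = 4 * e / τ := by ring

lemma inv_apSigma_sq : (apSigma μ Y)⁻¹ ^ 2 = Var[apStat Y; μ]⁻¹ := by
  rw [inv_pow, apSigma, Real.sq_sqrt (variance_nonneg _ _)]

variable [IsProbabilityMeasure μ] {r : ℝ}

lemma IsNearlyExchangeable.apSigma_pos (h : IsNearlyExchangeable Y μ r) (hn : 2 ≤ n)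
    (hr : 21 * r + 2 * harmonic n / n < 1 / 12) : 0 < apSigma μ Y := by
  have hvar := abs_le.1 (h.abs_variance_apStat_sub_le hn)
  exact Real.sqrt_pos.2 <| pos_of_mul_pos_right
    (by linarith : 0 < ((n : ℝ) - 1) ^ 2 / n * Var[apStat Y; μ]) (by positivity)

theorem IsNearlyExchangeable.abs_bootstrapVariance_sub_variance_le
    (h : IsNearlyExchangeable Y μ r) (hn : 2 ≤ n) {x : Fin n → ℝ} (hx : Function.Injective x)
    {e : ℝ} (hr : 21 * max r (n : ℝ)⁻¹ + 2 * harmonic n / n ≤ e) (he : e ≤ 1 / 24) :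
    |bootstrapVariance (fun x => (apSigma μ Y)⁻¹ * apU n x) x
      - Var[fun ω => (apSigma μ Y)⁻¹ * apStat Y ω; μ]| ≤ 48 * e := by
  have hn0 : n ≠ 0 := by lia
  have := isProbabilityMeasure_bootstrapLaw hn0 x
  have hr' : 21 * r + 2 * harmonic n / n ≤ e := hr.trans' (by gcongr; exact le_max_left _ _)
  have hvar : |((n : ℝ) - 1) ^ 2 / n * Var[apStat Y; μ] - 1 / 12| ≤ e :=
    (h.abs_variance_apStat_sub_le hn).trans hr'
  have hboot : |((n : ℝ) - 1) ^ 2 / n * bootstrapVariance (apU n) x - 1 / 12| ≤ e :=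
    ((isNearlyExchangeable_bootstrapLaw hn0 hx).abs_variance_apStat_sub_le hn).trans <|
      hr.trans' (by gcongr; exact le_max_right _ _)
  have hpos : 0 < Var[apStat Y; μ] := Real.sqrt_pos.1 (h.apSigma_pos hn (by linarith))
  have hscale : bootstrapVariance (fun x => (apSigma μ Y)⁻¹ * apU n x) x
      = Var[apStat Y; μ]⁻¹ * bootstrapVariance (apU n) x := by
    rw [bootstrapVariance, variance_const_mul, inv_apSigma_sq, bootstrapVariance]
  rw [hscale, variance_const_mul, inv_apSigma_sq, inv_mul_cancel₀ hpos.ne']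
  linarith [abs_inv_mul_sub_one_le (by norm_num) hvar hboot (by linarith)]

end VarianceRatio

section Asymptotics

lemma tendsto_const_mul_rpow_neg_mul_log_pow (C : ℝ) {s : ℝ} (hs : 0 < s) (k : ℕ) :
    Tendsto (fun n : ℕ => C * (n : ℝ) ^ (-s) * Real.log n ^ k) atTop (𝓝 0) := by
  have hlog := ((isLittleO_log_rpow_rpow_atTop (k : ℝ) hs).tendsto_div_nhds_zero.comp
    tendsto_natCast_atTop_atTop).const_mul C
  rw [mul_zero] at hlog
  refine hlog.congr fun n => ?_
  simp only [Function.comp_apply]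
  rw [Real.rpow_neg n.cast_nonneg, Real.rpow_natCast, div_eq_inv_mul, mul_assoc]

lemma tendsto_harmonic_div_atTop : Tendsto (fun n : ℕ => (harmonic n : ℝ) / n) atTop (𝓝 0) := by
  refine (tendsto_one_div_add_atTop_nhds_zero_nat (𝕜 := ℝ)).cesaro.congr fun n => ?_
  simp [harmonic, div_eq_inv_mul]

end Asymptotics

theorem mainTheorem10_general
    {Ω : ℕ → Type*} [∀ n, MeasurableSpace (Ω n)]
    (P : (n : ℕ) → Measure (Ω n)) [∀ n, IsProbabilityMeasure (P n)]
    (X : (n : ℕ) → Fin n → Ω n → ℝ)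
    (hX_meas : ∀ n i, Measurable (X n i))
    (hX_indep : ∀ n, iIndepFun (X n) (P n))
    (hX_inj : ∀ n, ∀ᵐ ω ∂P n, Function.Injective fun i => X n i ω)
    (θ κ a b : ℕ → ℝ) (ha : Tendsto a atTop (𝓝 0)) (hb : Tendsto b atTop (𝓝 0))
    (hθ_approx : ∀ᶠ n in atTop, ∀ i j : Fin n, i ≠ j →
      |(P n).real {ω | X n i ω > X n j ω} - θ n| ≤ a n)
    (hκ_approx : ∀ᶠ n in atTop, ∀ i j k : Fin n, j ≠ i → k ≠ i → j ≠ k →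
      |(∫ ω, condProbGT (P n) (X n j) (X n i) ω * condProbGT (P n) (X n k) (X n i) ω ∂(P n))
        - κ n| ≤ b n) :
    (∀ᶠ n in atTop, 0 < apSigma (P n) (X n)) ∧
    ∀ ε : ℝ, 0 < ε →
      Tendsto (fun n => P n {ω | ε ≤
        |bootstrapVariance (fun x => (apSigma (P n) (X n))⁻¹ * apU n x) (fun i => X n i ω)
          - variance (fun ω' => (apSigma (P n) (X n))⁻¹ * apStat (X n) ω') (P n)|})
        atTop (𝓝 0) := by
  have he_lim : Tendsto (fun n : ℕ =>
      21 * max (2 * max (a n) (b n)) (n : ℝ)⁻¹ + 2 * harmonic n / n) atTop (𝓝 0) := by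
    have hmax := ((ha.max hb).const_mul 2).max (tendsto_inv_atTop_nhds_zero_nat (𝕜 := ℝ))
    simpa [mul_div_assoc] using (hmax.const_mul 21).add (tendsto_harmonic_div_atTop.const_mul 2)
  have hnear : ∀ᶠ n in atTop, IsNearlyExchangeable (X n) (P n) (2 * max (a n) (b n)) := by
    filter_upwards [hθ_approx, hκ_approx] with n hθn hκn
    exact .of_ae_injective (hX_meas n) (hX_indep n) (hX_inj n) hθn hκn
  have hbound (c : ℝ) (hc : 0 < c) := hnear.and <| (eventually_ge_atTop 2).and <|
    he_lim.eventually_lt_const hc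
  refine ⟨?_, fun ε hε => tendsto_const_nhds.congr' ?_⟩
  · filter_upwards [hbound (1 / 12) (by norm_num)] with n ⟨h, hn, hlt⟩
    exact h.apSigma_pos hn (hlt.trans_le' (by gcongr; exact le_max_left _ _))
  · filter_upwards [hbound (1 / 24) (by norm_num), hbound (ε / 48) (by positivity)]
      with n ⟨h, hn, hlt⟩ ⟨_, _, hltε⟩
    refine (measure_eq_zero_iff_ae_notMem.2 ?_).symm
    filter_upwards [hX_inj n] with ω hω
    have := h.abs_bootstrapVariance_sub_variance_le hn hω le_rfl hlt.le
    exact not_le.2 (by linarith)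

theorem mainTheorem10
    {Ω : ℕ → Type*} [∀ n, MeasurableSpace (Ω n)]
    (P : (n : ℕ) → Measure (Ω n)) [∀ n, IsProbabilityMeasure (P n)]
    (X : (n : ℕ) → Fin n → Ω n → ℝ)
    (hX_meas : ∀ n i, Measurable (X n i))
    (hX_indep : ∀ n, iIndepFun (X n) (P n))
    (hX_ac : ∀ n i, (P n).map (X n i) ≪ volume)
    (δ p : ℕ → ℝ)
    (hδ : ∀ n, δ n ∈ Set.Ioo (0 : ℝ) 1)
    (hp : ∀ n, p n ∈ Set.Ioo (0 : ℝ) 1)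
    (hδp : ∀ᶠ n in atTop, ∀ i : Fin n,
      p n ≤ (P n).real {ω | ∀ j : Fin n, j ≠ i →
        condProbGT (P n) (X n j) (X n i) ω - (P n).real {ω' | X n j ω' > X n i ω'}
          ∈ Set.Icc (δ n) 1} ∨
      p n ≤ (P n).real {ω | ∀ j : Fin n, j ≠ i →
        condProbGT (P n) (X n j) (X n i) ω - (P n).real {ω' | X n j ω' > X n i ω'}
          ∈ Set.Icc (-1) (-δ n)})
    (hrate : StrictlyDominates (fun n => δ n ^ 3 * p n)
      (fun n => (n : ℝ) ^ (-(1 / 3) : ℝ) * Real.log n ^ 2))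
    (θ : ℝ) (hθ : 0 < θ) (C₁ : ℝ) (hC₁ : 0 < C₁)
    (hθ_approx : ∀ n, ∀ i j : Fin n, i ≠ j →
      |(P n).real {ω | X n i ω > X n j ω} - θ|
        ≤ C₁ * (n : ℝ) ^ (-(1 / 6) : ℝ) * Real.log n)
    (η : ℝ) (hη : 0 < η ^ 2) (C₂ : ℝ) (hC₂ : 0 < C₂)
    (hη_approx : ∀ n, ∀ i j k : Fin n, j ≠ i → k ≠ i →
      |(∫ ω, condProbGT (P n) (X n j) (X n i) ω * condProbGT (P n) (X n k) (X n i) ω ∂(P n))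
          - η ^ 2|
        ≤ C₂ * (n : ℝ) ^ (-(1 / 3) : ℝ) * Real.log n ^ 2)
    (hηθ : η ^ 2 ≠ θ ^ 2) :
    (∀ᶠ n in atTop, 0 < apSigma (P n) (X n)) ∧
    ∀ ε : ℝ, 0 < ε →
      Tendsto (fun n => P n {ω | ε ≤
        |bootstrapVariance (fun x => (apSigma (P n) (X n))⁻¹ * apU n x) (fun i => X n i ω)
          - variance (fun ω' => (apSigma (P n) (X n))⁻¹ * apStat (X n) ω') (P n)|})
        atTop (𝓝 0) := by
  have hX_inj (n : ℕ) : ∀ᵐ ω ∂P n, Function.Injective fun i => X n i ω :=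
    ae_injective_of_iIndepFun (hX_meas n) (hX_indep n)
      fun i => ⟨fun y => hX_ac n i (measure_singleton y)⟩
  exact mainTheorem10_general P X hX_meas hX_indep hX_inj (fun _ => θ) (fun _ => η ^ 2) _ _
    (by simpa using tendsto_const_mul_rpow_neg_mul_log_pow C₁ (s := 1 / 6) (by norm_num) 1)
    (tendsto_const_mul_rpow_neg_mul_log_pow C₂ (s := 1 / 3) (by norm_num) 2)
    (.of_forall hθ_approx) (.of_forall fun n i j k hji hki _ => hη_approx n i j k hji hki)
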